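/- **Theorem (Bolzano–Weierstraß Theorem).** For every computable metric space $X$, $$\mathsf{BWT}_X\;\equiv_{\mathrm{sW}}\;\mathsf{K}_X',$$ i.e. the Bolzano–Weierstraß problem of $X$ is strongly Weihrauch equivalent to the jump of compact choice of $X$. Here a *computable metric space* is a metric space $(X,d)$ with a dense sequence $\alpha:\mathbb N\to X$ such that $(d(\alpha(i),\alpha(j)))_{i,j}$ is a computable double sequence of real numbers; $X$ carries the Cauchy representation ($p$ names $x$ iff $d(\alpha(p(n)),\alpha(p(k)))<2^{-n}$ for all $k>n$ and $\lim_n\alpha(p(n))=x$), and $X^{\mathbb N}$ the induced representation of sequences. * $\mathsf{BWT}_X:\subseteq X^{\mathbb N}\rightrightarrows X$ is the partial multi-valued function whose domain consists of the sequences $(x_n)$ such that $\overline{\{x_n:n\in\mathbb N\}}$ is compact, and $\mathsf{BWT}_X((x_n))$ is the set of cluster points of $(x_n)$. * $\mathsf{K}_X:\subseteq\mathcal K_-(X)\rightrightarrows X$, $A\mapsto A$, is defined on the non-empty compact sets $A\subseteq X$, where the set $\mathcal K_-(X)$ of compact subsets of $X$ carries the representation $\kappa_-$: a name of $A$ is a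 list of (codes of) all finite covers of $A$ by open balls with centres $\alpha(n)$ and non-negative rational radii. * For a multi-valued function $f:\subseteq(U,\delta_U)\rightrightarrows(V,\delta_V)$ on represented spaces, the *jump* $f'$ is the same multi-valued function, with $\delta_U$ replaced by $\delta_U\circ\lim$, where $\lim\langle p_0,p_1,\dots\rangle=\lim_i p_i$ in Baire space. * A partial function $F$ on Baire space *realizes* $f$ if, for every name $p$ of a point $u\in\mathrm{dom}(f)$, $F(p)$ is defined and is a name of a point of $f(u)$. One writes $f\le_{\mathrm{sW}}g$ if there are computable partial functions $K,H$ on Baire space such that $K\circ G\circ H$ realizes $f$ for every $G$ realizing $g$, and $f\equiv_{\mathrm{sW}}g$ if $f\le_{\mathrm{sW}}g$ and $g\le_{\mathrm{sW}}f$. -/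

import Mathlib

open Set Filter Topology

/-! ### Computable partial functions on Baire space `ℕ → ℕ` -/

/-- The word `p(0) p(1) … p(n-1)`. -/
def initSeg (p : ℕ → ℕ) (n : ℕ) : List ℕ := (List.range n).map p

/-- A partial function `F` on Baire space is computable if some computable, prefix-monotone function
`h` on finite words approximates it: `F p = q` iff `q` is the (infinite) supremum of the words
`h (p(0) … p(m-1))`; `p` is outside the domain iff this supremum is a finite word. -/
def BaireComputable (F : (ℕ → ℕ) →. (ℕ → ℕ)) : Prop :=
  ∃ h : List ℕ → List ℕ, Computable h ∧ (∀ u v, u <+: v → h u <+: h v) ∧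
    ∀ p q : ℕ → ℕ, q ∈ F p ↔ ∀ n, ∃ m, initSeg q n <+: h (initSeg p m)

/-! ### Representations -/

/-- A representation of `X`: a partial surjection from Baire space onto `X`, given by its graph;
`names p x` says that `p` is in the domain and is mapped to `x`. -/
structure BaireRep (X : Type*) where
  names : (ℕ → ℕ) → X → Prop
  functional : ∀ p x y, names p x → names p y → x = y
  surjective : ∀ x, ∃ p, names p x

/-- The `i`-th component of `⟨p₀, p₁, p₂, …⟩`, where `⟨p₀, p₁, …⟩ ⟨i, j⟩ = pᵢ j`. -/
def component (p : ℕ → ℕ) (i : ℕ) : ℕ → ℕ := fun j => p (Nat.pair i j)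

/-- `q = lim p`: the components of `p = ⟨p₀, p₁, p₂, …⟩` converge to `q` in Baire space
(product topology of the discrete topology on `ℕ`). -/
def IsBaireLim (p q : ℕ → ℕ) : Prop := Tendsto (component p) atTop (𝓝 q)

/-- The jump `δ' = δ ∘ lim` of a representation. -/
def BaireRep.jump {X : Type*} (δ : BaireRep X) : BaireRep X where
  names p x := ∃ q, IsBaireLim p q ∧ δ.names q x
  functional := by
    rintro p x y ⟨q, hq, hx⟩ ⟨q', hq', hy⟩
    obtain rfl := tendsto_nhds_unique hq hq'
    exact δ.functional _ _ _ hx hy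
  surjective x := by
    obtain ⟨q, hq⟩ := δ.surjective x
    refine ⟨fun n => q n.unpair.2, q, ?_, hq⟩
    have : component (fun n => q n.unpair.2) = fun _ => q := by
      funext i j; simp [component]
    rw [IsBaireLim, this]
    exact tendsto_const_nhds

/-- The representation `δ^ℕ` of the set of sequences in `X`. -/
def BaireRep.seq {X : Type*} (δ : BaireRep X) : BaireRep (ℕ → X) where
  names p x := ∀ i, δ.names (component p i) (x i)
  functional p x y hx hy := funext fun i => δ.functional _ _ _ (hx i) (hy i)
  surjective x := by
    choose q hq using fun i => δ.surjective (x i)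
    refine ⟨fun n => q n.unpair.1 n.unpair.2, fun i => ?_⟩
    have : component (fun n => q n.unpair.1 n.unpair.2) i = q i := by
      funext j; simp [component]
    rw [this]
    exact hq i

/-! ### Multi-valued functions on represented spaces and strong Weihrauch reducibility -/

/-- A partial multi-valued function between represented spaces. The set of values at `x` is `val x`,
and the domain consists of the points with a non-empty set of values. -/
structure MultiFun (X Y : Type*) where
  src : BaireRep X
  tgt : BaireRep Y
  val : X → Set Y

namespace MultiFun

variable {X Y Z W : Type*}

/-- The domain of a partial multi-valued function. -/
def dom (f : MultiFun X Y) : Set X := {x | (f.val x).Nonempty}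

/-- `F ⊢ f`: the partial function `F` on Baire space is a realizer of `f`. -/
def Realizes (F : (ℕ → ℕ) →. (ℕ → ℕ)) (f : MultiFun X Y) : Prop :=
  ∀ p x, f.src.names p x → x ∈ f.dom → ∃ q ∈ F p, ∃ y ∈ f.val x, f.tgt.names q y

/-- Strong Weihrauch reducibility: there are computable partial functions `K`, `H` on Baire space
such that `K G H` realizes `f` whenever `G` realizes `g`. -/
def StrongReducible (f : MultiFun X Y) (g : MultiFun Z W) : Prop :=
  ∃ K H : (ℕ → ℕ) →. (ℕ → ℕ), BaireComputable K ∧ BaireComputable H ∧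
    ∀ G : (ℕ → ℕ) →. (ℕ → ℕ), Realizes G g → Realizes (K.comp (G.comp H)) f

/-- Strong Weihrauch equivalence. -/
def StrongEquiv (f : MultiFun X Y) (g : MultiFun Z W) : Prop :=
  StrongReducible f g ∧ StrongReducible g f

/-- The derivative (jump) `f'`: the same multi-valued function, with the jump of the input
representation. -/
def derivative (f : MultiFun X Y) : MultiFun X Y where
  src := f.src.jump
  tgt := f.tgt
  val := f.val

end MultiFun

infix:50 " ≡sW " => MultiFun.StrongEquiv

/-! ### Computable metric spaces -/

/-- A standard numbering of the rational numbers: `⟨⟨a, b⟩, c⟩ ↦ (a - b) / (c + 1)`. -/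
def ratNum (n : ℕ) : ℚ :=
  ((n.unpair.1.unpair.1 : ℚ) - (n.unpair.1.unpair.2 : ℚ)) / ((n.unpair.2 : ℚ) + 1)

/-- A standard numbering of the non-negative rational numbers: `⟨a, b⟩ ↦ a / (b + 1)`. -/
def nonnegRatNum (n : ℕ) : ℚ := (n.unpair.1 : ℚ) / ((n.unpair.2 : ℚ) + 1)

/-- A computable metric space: a metric space with a dense sequence `α` whose mutual distances
`d (α i) (α j)` form a computable (double) sequence of real numbers. -/
class ComputableMetricSpace (X : Type*) extends MetricSpace X where
  α : ℕ → X
  denseRange_α : DenseRange α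
  computable_dist : ∃ φ : ℕ × ℕ × ℕ → ℕ, Computable φ ∧
    ∀ i j k, |(ratNum (φ (i, j, k)) : ℝ) - dist (α i) (α j)| < (2 : ℝ)⁻¹ ^ k

namespace ComputableMetricSpace

variable (X : Type*) [ComputableMetricSpace X]

/-- The Cauchy representation: `p` names `x` if `α (p 0), α (p 1), …` is a rapidly converging
Cauchy sequence with limit `x`. -/
def cauchyRep : BaireRep X where
  names p x := (∀ n k, n < k → dist (α (X := X) (p n)) (α (p k)) < (2 : ℝ)⁻¹ ^ n) ∧
    Tendsto (fun n => α (X := X) (p n)) atTop (𝓝 x)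
  functional _ _ _ hx hy := tendsto_nhds_unique hx.2 hy.2
  surjective x := by
    have h : ∀ n : ℕ, ∃ i, dist (α (X := X) i) x < (2 : ℝ)⁻¹ ^ (n + 1) := fun n => by
      obtain ⟨i, hi⟩ := (denseRange_α (X := X)).exists_dist_lt x
        (show (0 : ℝ) < (2 : ℝ)⁻¹ ^ (n + 1) by positivity)
      exact ⟨i, by rwa [dist_comm]⟩
    choose p hp using h
    refine ⟨p, fun n k hnk => ?_, ?_⟩
    · have h1 : (2 : ℝ)⁻¹ ^ (k + 1) ≤ (2 : ℝ)⁻¹ ^ (n + 1) :=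
        pow_le_pow_of_le_one (by norm_num) (by norm_num) (by omega)
      have h2 : (2 : ℝ)⁻¹ ^ (n + 1) = (2 : ℝ)⁻¹ ^ n / 2 := by rw [pow_succ]; ring
      have h3 := dist_triangle_right (α (X := X) (p n)) (α (p k)) x
      have h4 := hp n
      have h5 := hp k
      linarith
    · rw [tendsto_iff_dist_tendsto_zero]
      refine squeeze_zero (fun _ => dist_nonneg) (fun n => (hp n).le) ?_
      exact (tendsto_pow_atTop_nhds_zero_of_lt_one (by norm_num) (by norm_num)).comp
        (tendsto_add_atTop_nat 1)

/-- The rational open ball with code `⟨n, k⟩`: centre `α n`, radius the `k`-th non-negative rational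
number (the radius `0` gives the empty ball). -/
def ratBall (b : ℕ) : Set X := Metric.ball (α b.unpair.1) (nonnegRatNum b.unpair.2 : ℝ)

/-- The union of the finite list of rational open balls that is coded by `c`. -/
def ratBalls (c : ℕ) : Set X := ⋃ b ∈ Denumerable.ofNat (List ℕ) c, ratBall X b

variable {X}

/-- Every neighbourhood of a compact set contains the union of some finite rational cover of it. -/
theorem exists_ratBalls {K U : Set X} (hK : IsCompact K) (hU : IsOpen U) (hKU : K ⊆ U) :
    ∃ c, K ⊆ ratBalls X c ∧ ratBalls X c ⊆ U := by
  have key : ∀ x ∈ K, ∃ b, x ∈ ratBall X b ∧ ratBall X b ⊆ U := by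
    intro x hx
    obtain ⟨ε, hε, hb⟩ := Metric.isOpen_iff.1 hU x (hKU hx)
    obtain ⟨N, hN⟩ := exists_nat_one_div_lt (half_pos hε)
    have hN0 : (0 : ℝ) < 1 / ((N : ℝ) + 1) := by positivity
    obtain ⟨i, hi⟩ := (denseRange_α (X := X)).exists_dist_lt x hN0
    have hr : ((nonnegRatNum (Nat.pair 1 N) : ℚ) : ℝ) = 1 / ((N : ℝ) + 1) := by
      simp [nonnegRatNum]
    have hball : ratBall X (Nat.pair i (Nat.pair 1 N)) = Metric.ball (α i) (1 / ((N : ℝ) + 1)) := by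
      rw [ratBall, Nat.unpair_pair, hr]
    refine ⟨Nat.pair i (Nat.pair 1 N), ?_, ?_⟩
    · rw [hball]; exact hi
    · rw [hball]
      intro y hy
      apply hb
      rw [Metric.mem_ball] at hy ⊢
      have := dist_triangle y (α i) x
      rw [dist_comm (α i) x] at this
      linarith
  choose! b hb hbU using key
  obtain ⟨t, ht, hcov⟩ := hK.elim_nhds_subcover (fun x => ratBall X (b x))
    (fun x hx => Metric.isOpen_ball.mem_nhds (hb x hx))
  refine ⟨Encodable.encode (t.toList.map b), ?_, ?_⟩
  · intro x hx
    simpa [ratBalls] using hcov hx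
  · simp only [ratBalls, Denumerable.ofNat_encode, iUnion_subset_iff, List.mem_map,
      Finset.mem_toList]
    rintro _ ⟨x, hx, rfl⟩
    exact hbU x (ht x hx)

variable (X)

/-- The representation `κ₋` of the set of all compact subsets of `X` (the empty set included):
a name of `K` is a list of all finite rational open covers of `K`. -/
def compactRep : BaireRep (TopologicalSpace.Compacts X) where
  names p K := ∀ c, (∃ i, p i = c) ↔ (K : Set X) ⊆ ratBalls X c
  functional := by
    have key : ∀ (p : ℕ → ℕ) (K L : TopologicalSpace.Compacts X),
        (∀ c, (∃ i, p i = c) ↔ (K : Set X) ⊆ ratBalls X c) →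
        (∀ c, (∃ i, p i = c) ↔ (L : Set X) ⊆ ratBalls X c) → (K : Set X) ⊆ L := by
      intro p K L hK hL x hx
      by_contra hxL
      obtain ⟨c, hc, hcU⟩ := exists_ratBalls L.isCompact
        (isOpen_compl_singleton (x := x)) (fun y hy hyx => hxL (by rwa [← hyx]))
      exact hcU ((hK c).1 ((hL c).2 hc) hx) rfl
    intro p K L hK hL
    exact SetLike.coe_injective (Subset.antisymm (key p K L hK hL) (key p L K hL hK))
  surjective K := by
    obtain ⟨c, hc, -⟩ := exists_ratBalls K.isCompact isOpen_univ (subset_univ _)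
    obtain ⟨p, hp⟩ := (Set.to_countable {c | (K : Set X) ⊆ ratBalls X c}).exists_eq_range ⟨c, hc⟩
    exact ⟨p, fun c => by rw [← Set.mem_range, ← hp, mem_ofPred_eq]⟩

/-- Compact choice `K_X`: given a non-empty compact set, find a point in it. -/
def compactChoice : MultiFun (TopologicalSpace.Compacts X) X where
  src := compactRep X
  tgt := cauchyRep X
  val K := (K : Set X)

/-- The Bolzano-Weierstraß problem `BWT_X`: given a sequence whose range has compact closure, find
a cluster point. -/
def BWT : MultiFun (ℕ → X) X where
  src := (cauchyRep X).seq
  tgt := cauchyRep X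
  val u := {x | IsCompact (closure (range u)) ∧ MapClusterPt x atTop u}

/-- The domain of `BWT_X` is the set of all sequences with relatively compact range. -/
theorem mem_dom_BWT (u : ℕ → X) : u ∈ (BWT X).dom ↔ IsCompact (closure (range u)) := by
  refine ⟨fun ⟨_, h, _⟩ => h, fun h => ?_⟩
  obtain ⟨x, -, hx⟩ := h.exists_mapClusterPt_of_frequently (f := u) (l := atTop)
    (Frequently.of_forall fun n => subset_closure (mem_range_self n))
  exact ⟨x, h, hx⟩

end ComputableMetricSpace

/-! Both reductions only preprocess the input, and the outer function is the identity.

From the jump of compact choice to `BWT`: a name of a nonempty compact `K` is given as a limit, so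
stage `s` offers a guess at its list of covers. Choose at stage `s` a dense point verified to lie in
as many of the first guessed sets as possible. As `K` is nonempty, any finitely many true covers
have a nonempty open intersection, which contains a dense point; hence the chosen points eventually
stay in each cover, and so in each neighbourhood of `K`. Such a sequence is relatively compact
(`isCompact_closure_range`) and clusters only in `K` (`mem_of_mapClusterPt`).

From `BWT` to the jump: the set of cluster points of a relatively compact sequence is compact, and a
finite union of rational balls covers it iff, for some `n`, the terms from index `n` on lie in the
balls shrunk by a margin of order `2⁻ⁿ`. For fixed `n` this is a universal condition that a finite
computation can refute, so a list of all covers is computable in the limit.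

Both need a decidable substitute for membership in a ball, with soundness and completeness separated
by a margin: `exists_near`. Computability of the preprocessing is assembled from closure properties
of `OracleComputable` and transferred by `OracleComputable.baireComputable`. -/

/-! ### Initial segments of points of Baire space -/

theorem length_initSeg (p : ℕ → ℕ) (n : ℕ) : (initSeg p n).length = n := by simp [initSeg]

theorem getElem?_initSeg (p : ℕ → ℕ) {n i : ℕ} (h : i < n) : (initSeg p n)[i]? = some (p i) := by
  simp [initSeg, h]

theorem initSeg_succ (p : ℕ → ℕ) (n : ℕ) : initSeg p (n + 1) = initSeg p n ++ [p n] := by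
  simp [initSeg, List.range_succ]

theorem initSeg_prefix (p : ℕ → ℕ) {m n : ℕ} (h : m ≤ n) : initSeg p m <+: initSeg p n := by
  induction n, h using Nat.le_induction with
  | base => exact List.prefix_rfl
  | succ n _ ih => exact ih.trans (by rw [initSeg_succ]; exact List.prefix_append _ _)

theorem eq_of_initSeg_prefix {p q : ℕ → ℕ} {m n i : ℕ} (h : initSeg p m <+: initSeg q n)
    (hi : i < m) : p i = q i := by
  have hl := h.length_le
  rw [length_initSeg, length_initSeg] at hl
  obtain ⟨t, ht⟩ := h
  have h1 := getElem?_initSeg q (hi.trans_le hl)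
  rw [← ht, List.getElem?_append_left (by rwa [length_initSeg]), getElem?_initSeg p hi] at h1
  exact Option.some.inj h1

theorem exists_eq_initSeg (u : List ℕ) : ∃ p, u = initSeg p u.length := by
  refine ⟨fun i => u[i]?.getD 0, List.ext_getElem (by simp [initSeg]) fun i h _ => ?_⟩
  simp [initSeg, h]

theorem baireComputable_id : BaireComputable (PFun.id (ℕ → ℕ)) := by
  refine ⟨id, Computable.id, fun _ _ h => h, fun p q => ?_⟩
  have : q ∈ PFun.id (ℕ → ℕ) p ↔ q = p := Part.mem_some_iff
  rw [this]
  refine ⟨fun h n => ⟨n, by rw [h]; exact List.prefix_rfl⟩, fun h => funext fun i => ?_⟩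
  obtain ⟨m, hm⟩ := h (i + 1)
  exact eq_of_initSeg_prefix hm (Nat.lt_succ_self i)

/-! ### Functions that are computable relative to an oracle in Baire space -/

/-- A function `f p a` of an oracle `p` and a discrete argument `a` is computable if its values
can be computed from sufficiently long finite parts of `p`. -/
def OracleComputable {α β : Type*} [Primcodable α] [Primcodable β]
    (f : (ℕ → ℕ) → α → β) : Prop :=
  ∃ E : List ℕ → α → Option β, Computable₂ E ∧
    (∀ u v a b, u <+: v → E u a = some b → E v a = some b) ∧
    ∀ p a, ∃ m, E (initSeg p m) a = some (f p a)

namespace OracleComputable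

/-- The form that lets finitely many queries be answered at one common stage. -/
theorem eventually_eq {α β : Type*} {E : List ℕ → α → Option β} {f : (ℕ → ℕ) → α → β}
    (hE : ∀ u v a b, u <+: v → E u a = some b → E v a = some b)
    (hf : ∀ p a, ∃ m, E (initSeg p m) a = some (f p a)) (p : ℕ → ℕ) (a : α) :
    ∀ᶠ m in atTop, E (initSeg p m) a = some (f p a) := by
  obtain ⟨m, hm⟩ := hf p a
  filter_upwards [eventually_ge_atTop m] with n hn
  exact hE _ _ _ _ (initSeg_prefix p hn) hm

/-- A value once output persists, so it must agree with the correct value that appears on some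
longer segment. -/
theorem sound {α β : Type*} {E : List ℕ → α → Option β} {f : (ℕ → ℕ) → α → β}
    (hE : ∀ u v a b, u <+: v → E u a = some b → E v a = some b)
    (hf : ∀ p a, ∃ m, E (initSeg p m) a = some (f p a)) {p : ℕ → ℕ} {n : ℕ} {a : α} {b : β}
    (h : E (initSeg p n) a = some b) : b = f p a := by
  obtain ⟨m, hm, hnm⟩ := ((eventually_eq hE hf p a).and (eventually_ge_atTop n)).exists
  have := hE _ _ _ _ (initSeg_prefix p hnm) h
  rw [hm] at this
  exact (Option.some.inj this).symm

variable {α β γ : Type*} [Primcodable α] [Primcodable β] [Primcodable γ]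

theorem of_computable {f : α → β} (hf : Computable f) : OracleComputable fun _ => f :=
  ⟨fun _ a => some (f a), (Computable.option_some.comp (hf.comp Computable.snd)).to₂,
    fun _ _ _ _ _ h => h, fun _ _ => ⟨0, rfl⟩⟩

theorem oracle : OracleComputable fun p (n : ℕ) => p n :=
  ⟨fun u n => u[n]?, Computable.list_getElem?, by
    rintro u _ n b ⟨t, rfl⟩ h
    exact (List.getElem?_append_left (List.getElem?_eq_some_iff.1 h).1).trans h,
    fun p n => ⟨n + 1, getElem?_initSeg p (Nat.lt_succ_self n)⟩⟩

theorem comp {f : (ℕ → ℕ) → β → γ} {g : (ℕ → ℕ) → α → β} (hf : OracleComputable f)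
    (hg : OracleComputable g) : OracleComputable fun p a => f p (g p a) := by
  obtain ⟨E, hE, hEm, hEf⟩ := hf
  obtain ⟨D, hD, hDm, hDf⟩ := hg
  refine ⟨fun u a => (D u a).bind (E u),
    (Computable.option_bind hD
      (hE.comp (Computable.fst.comp Computable.fst) Computable.snd).to₂).to₂, ?_, ?_⟩
  · intro u v a c huv h
    obtain ⟨b, hb, hc⟩ := Option.bind_eq_some_iff.1 h
    exact Option.bind_eq_some_iff.2 ⟨b, hDm _ _ _ _ huv hb, hEm _ _ _ _ huv hc⟩
  · intro p a
    obtain ⟨m, h1, h2⟩ :=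
      ((eventually_eq hDm hDf p a).and (eventually_eq hEm hEf p (g p a))).exists
    exact ⟨m, Option.bind_eq_some_iff.2 ⟨_, h1, h2⟩⟩

theorem pair {f : (ℕ → ℕ) → α → β} {g : (ℕ → ℕ) → α → γ} (hf : OracleComputable f)
    (hg : OracleComputable g) : OracleComputable fun p a => (f p a, g p a) := by
  obtain ⟨E, hE, hEm, hEf⟩ := hf
  obtain ⟨D, hD, hDm, hDf⟩ := hg
  refine ⟨fun u a => (E u a).bind fun b => (D u a).map fun c => (b, c),
    (Computable.option_bind hE (Computable.option_map (hD.comp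
      (Computable.fst.comp Computable.fst) (Computable.snd.comp Computable.fst))
      ((Computable.snd.comp Computable.fst).pair Computable.snd).to₂).to₂).to₂, ?_, ?_⟩
  · intro u v a c huv h
    simp only [Option.bind_eq_some_iff, Option.map_eq_some_iff] at h ⊢
    obtain ⟨b, hb, d, hd, rfl⟩ := h
    exact ⟨b, hEm _ _ _ _ huv hb, d, hDm _ _ _ _ huv hd, rfl⟩
  · intro p a
    obtain ⟨m, h1, h2⟩ :=
      ((eventually_eq hEm hEf p a).and (eventually_eq hDm hDf p a)).exists
    exact ⟨m, by simp [h1, h2]⟩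

/-- Post-composition with a computable function of two arguments. -/
theorem map₂ {δ : Type*} [Primcodable δ] {h : β → γ → δ} {f : (ℕ → ℕ) → α → β}
    {g : (ℕ → ℕ) → α → γ} (hh : Computable₂ h) (hf : OracleComputable f)
    (hg : OracleComputable g) : OracleComputable fun p a => h (f p a) (g p a) :=
  (of_computable hh).comp (hf.pair hg)

theorem map {h : β → γ} {f : (ℕ → ℕ) → α → β} (hh : Computable h) (hf : OracleComputable f) :
    OracleComputable fun p a => h (f p a) :=
  (of_computable hh).comp hf

end OracleComputable

/-! ### Bounded search and bounded quantifiers relative to an oracle -/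

/-- The least `i < n` that satisfies `P`, and `n` if there is none. -/
def boundedSearch (P : ℕ → Bool) : ℕ → ℕ
  | 0 => 0
  | n + 1 => bif P (boundedSearch P n) then boundedSearch P n else n + 1

theorem boundedSearch_spec (P : ℕ → Bool) (n : ℕ) :
    boundedSearch P n ≤ n ∧ (∀ i < boundedSearch P n, P i = false) ∧
      (boundedSearch P n < n → P (boundedSearch P n) = true) := by
  induction n with
  | zero => simp [boundedSearch]
  | succ n ih =>
    obtain ⟨h1, h2, h3⟩ := ih
    rw [boundedSearch]
    cases h : P (boundedSearch P n) with
    | true => exact ⟨h1.trans n.le_succ, by simpa using h2, by simp [h]⟩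
    | false =>
      have h4 : boundedSearch P n = n := by
        by_contra h5
        simp [h3 (lt_of_le_of_ne h1 h5)] at h
      rw [h4] at h h2
      refine ⟨le_rfl, fun i hi => ?_, fun hi => absurd hi (lt_irrefl _)⟩
      rcases Nat.lt_succ_iff_lt_or_eq.1 hi with hi | rfl
      exacts [h2 i hi, h]

theorem boundedSearch_lt_iff {P : ℕ → Bool} {n : ℕ} :
    boundedSearch P n < n ↔ ∃ i < n, P i = true := by
  obtain ⟨h1, h2, h3⟩ := boundedSearch_spec P n
  refine ⟨fun h => ⟨_, h, h3 h⟩, fun ⟨i, hi, hP⟩ => ?_⟩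
  by_contra h
  simp [h2 i (hi.trans_le (not_lt.1 h))] at hP

theorem boundedSearch_le_of {P : ℕ → Bool} {n i : ℕ} (hP : P i = true) :
    boundedSearch P n ≤ i := by
  by_contra h
  simp [(boundedSearch_spec P n).2.1 i (not_le.1 h)] at hP

theorem OracleComputable.boundedSearch {α : Type*} [Primcodable α]
    {P : (ℕ → ℕ) → α × ℕ → Bool} (hP : OracleComputable P) {n : (ℕ → ℕ) → α → ℕ}
    (hn : OracleComputable n) :
    OracleComputable fun p a => boundedSearch (fun i => P p (a, i)) (n p a) := by
  suffices h : OracleComputable fun p (x : α × ℕ) => _root_.boundedSearch (fun i => P p (x.1, i)) x.2 from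
    h.comp ((of_computable Computable.id).pair hn)
  obtain ⟨E, hE, hEm, hEf⟩ := hP
  -- The recursion of the search, run on partial answers: it is undefined as soon as one query is
  -- still unanswered.
  let D (u : List ℕ) (x : α × ℕ) : Option ℕ :=
    Nat.rec (some 0) (fun i r => r.bind fun r => (E u (x.1, r)).map fun b => bif b then r else i + 1)
      x.2
  have hD0 (u a) : D u (a, 0) = some 0 := rfl
  have hDs (u a n) : D u (a, n + 1) = (D u (a, n)).bind fun r => (E u (a, r)).map fun b =>
      bif b then r else n + 1 := rfl
  refine ⟨D, ?_, ?_, ?_⟩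
  · refine (Computable.nat_rec
      (h := fun (y : List ℕ × (α × ℕ)) (z : ℕ × Option ℕ) => z.2.bind fun r =>
        (E y.1 (y.2.1, r)).map fun b => bif b then r else z.1 + 1)
      (Computable.snd.comp Computable.snd) (Computable.const (some 0)) ?_).to₂
    have h1 : Computable fun x : ((List ℕ × α × ℕ) × ℕ × Option ℕ) × ℕ =>
        E x.1.1.1 (x.1.1.2.1, x.2) :=
      hE.comp (Computable.fst.comp (Computable.fst.comp Computable.fst))
        ((Computable.fst.comp (Computable.snd.comp (Computable.fst.comp Computable.fst))).pair
          Computable.snd)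
    have h2 : Computable₂ fun (x : ((List ℕ × α × ℕ) × ℕ × Option ℕ) × ℕ) (b : Bool) =>
        bif b then x.2 else x.1.2.1 + 1 :=
      (Computable.cond Computable.snd (Computable.snd.comp Computable.fst)
        (Computable.succ.comp (Computable.fst.comp (Computable.snd.comp
          (Computable.fst.comp Computable.fst))))).to₂
    exact (Computable.option_bind (Computable.snd.comp Computable.snd)
      (Computable.option_map h1 h2).to₂).to₂
  · rintro u v ⟨a, n⟩ b huv
    induction n generalizing b with
    | zero => exact id
    | succ n ih =>
      simp only [hDs, Option.bind_eq_some_iff, Option.map_eq_some_iff]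
      rintro ⟨r, hr, c, hc, rfl⟩
      exact ⟨r, ih r hr, c, hEm _ _ _ _ huv hc, rfl⟩
  · rintro p ⟨a, n⟩
    suffices h : ∀ᶠ m in atTop,
        D (initSeg p m) (a, n) = some (_root_.boundedSearch (fun i => P p (a, i)) n) from h.exists
    induction n with
    | zero => exact Eventually.of_forall fun _ => rfl
    | succ n ih =>
      filter_upwards [ih, eventually_eq hEm hEf p
        (a, _root_.boundedSearch (fun i => P p (a, i)) n)] with m h1 h2
      rw [hDs, h1, Option.bind_some, h2, Option.map_some, _root_.boundedSearch]

theorem OracleComputable.exists_lt {α : Type*} [Primcodable α]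
    {P : (ℕ → ℕ) → α × ℕ → Bool} (hP : OracleComputable P) {n : (ℕ → ℕ) → α → ℕ}
    (hn : OracleComputable n) :
    OracleComputable fun p a => decide (∃ i < n p a, P p (a, i) = true) := by
  simp only [← boundedSearch_lt_iff]
  exact map₂ (h := fun a b : ℕ => decide (a < b)) Primrec.nat_lt.decide.to_comp
    (hP.boundedSearch hn) hn

theorem OracleComputable.forall_lt {α : Type*} [Primcodable α]
    {P : (ℕ → ℕ) → α × ℕ → Bool} (hP : OracleComputable P) {n : (ℕ → ℕ) → α → ℕ}
    (hn : OracleComputable n) :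
    OracleComputable fun p a => decide (∀ i < n p a, P p (a, i) = true) := by
  have h := map Primrec.not.to_comp (exists_lt (map Primrec.not.to_comp hP) hn)
  convert h using 3
  rw [← decide_not]
  simp

/-! ### From oracle computability to computability on Baire space -/

/-- The longest list of values `E u 0, E u 1, …` that are defined, cut off at length `n`. -/
def outputWord (E : List ℕ → ℕ → Option ℕ) (u : List ℕ) : ℕ → List ℕ
  | 0 => []
  | n + 1 => ((E u (outputWord E u n).length).map fun b => outputWord E u n ++ [b]).getD
      (outputWord E u n)

theorem OracleComputable.baireComputable {f : (ℕ → ℕ) → ℕ → ℕ} (hf : OracleComputable f) :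
    BaireComputable fun p => Part.some (f p) := by
  obtain ⟨E, hE, hEm, hEf⟩ := hf
  -- Every output is an initial segment of `f p`, so prefix comparisons reduce to comparing lengths,
  -- which `hlen` does.
  have key (p : ℕ → ℕ) (m n : ℕ) : outputWord E (initSeg p m) n =
      initSeg (f p) (outputWord E (initSeg p m) n).length := by
    induction n with
    | zero => rfl
    | succ n ih =>
      rw [outputWord]
      cases h : E (initSeg p m) (outputWord E (initSeg p m) n).length with
      | none => simpa using ih
      | some b =>
        rw [sound hEm hEf h]
        simp only [Option.map_some, Option.getD_some, List.length_append, List.length_singleton]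
        rw [initSeg_succ, ← ih]
  have hlen (u v : List ℕ) (huv : u <+: v) (m n : ℕ) (hmn : m ≤ n) :
      (outputWord E u m).length ≤ (outputWord E v n).length := by
    have h1 (w : List ℕ) (k : ℕ) : (outputWord E w k).length ≤ (outputWord E w (k + 1)).length := by
      rw [outputWord]
      cases E w (outputWord E w k).length <;> simp
    refine le_trans ?_ (monotone_nat_of_le_succ (h1 v) hmn)
    clear hmn
    induction m with
    | zero => simp [outputWord]
    | succ m ih =>
      -- One step adds at most one letter, so a strictly shorter word cannot overtake; at equal
      -- lengths both words query the same position, and an answer from `u` is also one from `v`.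
      rcases ih.lt_or_eq with h | h
      · refine le_trans ?_ (h1 v m)
        refine le_trans ?_ h
        rw [outputWord]
        cases E u (outputWord E u m).length <;> simp
      · cases h2 : E u (outputWord E u m).length with
        | none =>
          rw [outputWord, h2]
          simpa [h] using h1 v m
        | some b =>
          rw [outputWord, outputWord, h2, ← h, hEm _ _ _ _ huv h2]
          simp [h]
  refine ⟨fun u => outputWord E u u.length, ?_, ?_, ?_⟩
  · have h : Computable fun u : List ℕ => (Nat.rec [] (fun _ l =>
        ((E u l.length).map fun b => l ++ [b]).getD l) u.length : List ℕ) := by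
      refine Computable.nat_rec
        (h := fun (u : List ℕ) (z : ℕ × List ℕ) => ((E u z.2.length).map fun b => z.2 ++ [b]).getD z.2)
        Computable.list_length (Computable.const []) ?_
      have h2 : Computable fun x : List ℕ × ℕ × List ℕ => x.2.2 :=
        Computable.snd.comp Computable.snd
      exact (Computable.option_getD (Computable.option_map
        (hE.comp Computable.fst (Computable.list_length.comp h2))
        (Computable.list_concat.comp (h2.comp Computable.fst) Computable.snd).to₂) h2).to₂
    refine h.of_eq fun u => ?_
    generalize u.length = n
    induction n with
    | zero => rfl
    | succ n ih => rw [outputWord, ← ih]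
  · intro u v huv
    obtain ⟨p, hp⟩ := exists_eq_initSeg v
    have hu : u = initSeg p u.length := by
      refine (List.prefix_of_prefix_length_le huv ?_ (length_initSeg p _).ge).eq_of_length
        (length_initSeg p _).symm
      conv_rhs => rw [hp]
      exact initSeg_prefix p huv.length_le
    have hl := hlen u v huv _ _ huv.length_le
    have e1 := key p u.length u.length
    have e2 := key p v.length v.length
    rw [← hu] at e1
    rw [← hp] at e2
    change outputWord E u u.length <+: outputWord E v v.length
    rw [e1, e2]
    exact initSeg_prefix _ hl
  · intro p q
    simp only [length_initSeg, Part.mem_some_iff]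
    constructor
    · rintro rfl n
      have h1 : ∀ᶠ m in atTop, ∀ i < n, E (initSeg p m) i = some (f p i) :=
        (Filter.eventually_all_finite (Set.finite_lt_nat n)).2 fun i _ => eventually_eq hEm hEf p i
      obtain ⟨m, hm, hnm⟩ := (h1.and (eventually_ge_atTop n)).exists
      refine ⟨m, ?_⟩
      have h2 : ∀ k ≤ n, k ≤ (outputWord E (initSeg p m) k).length := by
        intro k
        induction k with
        | zero => simp
        | succ k ih =>
          intro hk
          have h3 := ih (by omega)
          rw [outputWord]
          rcases h3.lt_or_eq with h4 | h4
          · cases E (initSeg p m) (outputWord E (initSeg p m) k).length <;> simp <;> omega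
          · rw [← h4, hm k (by omega)]
            simp [← h4]
      rw [key p m m]
      exact initSeg_prefix _ ((h2 n le_rfl).trans (hlen _ _ List.prefix_rfl _ _ hnm))
    · intro h
      funext i
      obtain ⟨m, hm⟩ := h (i + 1)
      rw [key p m m] at hm
      exact eq_of_initSeg_prefix hm (Nat.lt_succ_self i)

/-! ### Rational balls around points of the dense sequence -/

/-- Comparison of the numbers `ratNum m + 3 * 2⁻ⁿ` and `nonnegRatNum r` by means of natural
numbers. -/
def ratNumLt (x : (ℕ × ℕ) × ℕ) : Bool :=
  decide (x.1.1.unpair.1.unpair.1 * 2 ^ x.2 * (x.1.2.unpair.2 + 1) +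
      3 * (x.1.1.unpair.2 + 1) * (x.1.2.unpair.2 + 1) <
    x.1.2.unpair.1 * (x.1.1.unpair.2 + 1) * 2 ^ x.2 +
      x.1.1.unpair.1.unpair.2 * 2 ^ x.2 * (x.1.2.unpair.2 + 1))

theorem primrec_ratNumLt : Primrec ratNumLt := by
  have u1 {f : (ℕ × ℕ) × ℕ → ℕ} (hf : Primrec f) : Primrec fun x => (f x).unpair.1 :=
    Primrec.fst.comp (Primrec.unpair.comp hf)
  have u2 {f : (ℕ × ℕ) × ℕ → ℕ} (hf : Primrec f) : Primrec fun x => (f x).unpair.2 :=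
    Primrec.snd.comp (Primrec.unpair.comp hf)
  have hm : Primrec fun x : (ℕ × ℕ) × ℕ => x.1.1 := Primrec.fst.comp Primrec.fst
  have hr : Primrec fun x : (ℕ × ℕ) × ℕ => x.1.2 := Primrec.snd.comp Primrec.fst
  have hpow : Primrec fun x : (ℕ × ℕ) × ℕ => 2 ^ x.2 :=
    (Primrec₂.unpaired'.1 Nat.Primrec.pow).comp (Primrec.const 2) Primrec.snd
  have mul {f g : (ℕ × ℕ) × ℕ → ℕ} (hf : Primrec f) (hg : Primrec g) :
      Primrec fun x => f x * g x := Primrec.nat_mul.comp hf hg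
  have add {f g : (ℕ × ℕ) × ℕ → ℕ} (hf : Primrec f) (hg : Primrec g) :
      Primrec fun x => f x + g x := Primrec.nat_add.comp hf hg
  have hC := Primrec.succ.comp (u2 hm)
  have hE := Primrec.succ.comp (u2 hr)
  exact Primrec.nat_lt.decide.comp
    (add (mul (mul (u1 (u1 hm)) hpow) hE) (mul (mul (Primrec.const 3) hC) hE))
    (add (mul (mul (u1 hr) hC) hpow) (mul (mul (u2 (u1 hm)) hpow) hE))

/-- Denominators are cleared and the negative part is moved across, so that no truncated subtraction
occurs. -/
theorem ratNumLt_iff (m r n : ℕ) : ratNumLt ((m, r), n) = true ↔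
    (ratNum m : ℝ) + 3 * (2 : ℝ)⁻¹ ^ n < (nonnegRatNum r : ℝ) := by
  have hC : (0 : ℝ) < m.unpair.2 + 1 := by positivity
  have hE : (0 : ℝ) < r.unpair.2 + 1 := by positivity
  have hp : (0 : ℝ) < 2 ^ n := by positivity
  simp only [ratNumLt, ratNum, nonnegRatNum, decide_eq_true_eq]
  push_cast
  rw [← Nat.cast_lt (α := ℝ), inv_pow, ← div_eq_mul_inv, div_add_div _ _ hC.ne' hp.ne',
    div_lt_div_iff₀ (mul_pos hC hp) hE]
  push_cast
  constructor <;> intro h <;> linarith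

namespace ComputableMetricSpace

/-- The test compares an approximate distance plus `3 * 2⁻ⁿ` with the radius. The approximation
error is below `2⁻ⁿ`, which gives the margins 2 for soundness and 4 for completeness. -/
theorem exists_near (X : Type*) [ComputableMetricSpace X] : ∃ near : ℕ × ℕ × ℕ → Bool,
    OracleComputable (fun _ => near) ∧
    (∀ a c n, near (a, c, n) = true → ∃ b ∈ Denumerable.ofNat (List ℕ) c,
      dist (α (X := X) a) (α b.unpair.1) + 2 * (2 : ℝ)⁻¹ ^ n < nonnegRatNum b.unpair.2) ∧
    ∀ a c n b, b ∈ Denumerable.ofNat (List ℕ) c →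
      dist (α (X := X) a) (α b.unpair.1) + 4 * (2 : ℝ)⁻¹ ^ n ≤ nonnegRatNum b.unpair.2 →
      near (a, c, n) = true := by
  obtain ⟨φ, hφ, hφd⟩ := computable_dist (X := X)
  -- The default `0` is never consulted: only positions below the length of the list are searched.
  let entry (y : (ℕ × ℕ × ℕ) × ℕ) : ℕ := ((Denumerable.ofNat (List ℕ) y.1.2.1)[y.2]?).getD 0
  let Q (y : (ℕ × ℕ × ℕ) × ℕ) : Bool :=
    ratNumLt ((φ (y.1.1, (entry y).unpair.1, y.1.2.2), (entry y).unpair.2), y.1.2.2)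
  have hc : Computable fun y : ℕ × ℕ × ℕ => Denumerable.ofNat (List ℕ) y.2.1 :=
    (Computable.ofNat _).comp (Computable.fst.comp Computable.snd)
  have hentry : Computable entry :=
    Computable.option_getD (Computable.list_getElem?.comp (hc.comp Computable.fst) Computable.snd)
      (Computable.const 0)
  have hn : Computable fun y : (ℕ × ℕ × ℕ) × ℕ => y.1.2.2 :=
    Computable.snd.comp (Computable.snd.comp Computable.fst)
  have hb := Computable.unpair.comp hentry
  have hQ : Computable Q := primrec_ratNumLt.to_comp.comp
    (((hφ.comp ((Computable.fst.comp Computable.fst).pair ((Computable.fst.comp hb).pair hn))).pair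
      (Computable.snd.comp hb)).pair hn)
  refine ⟨fun x => decide (∃ i < (Denumerable.ofNat (List ℕ) x.2.1).length, Q (x, i) = true),
    (OracleComputable.of_computable hQ).exists_lt
      (OracleComputable.of_computable (Computable.list_length.comp hc)), ?_, ?_⟩
  · intro a c n h
    obtain ⟨i, hi, h⟩ := of_decide_eq_true h
    have he : entry ((a, c, n), i) = (Denumerable.ofNat (List ℕ) c)[i] := by
      simp only [entry, List.getElem?_eq_getElem hi, Option.getD_some]
    refine ⟨entry ((a, c, n), i), by rw [he]; exact List.getElem_mem hi, ?_⟩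
    have h1 := (ratNumLt_iff _ _ _).1 h
    have h2 := (abs_lt.1 (hφd a (entry ((a, c, n), i)).unpair.1 n)).1
    dsimp only at h1
    linarith
  · intro a c n b hb hd
    obtain ⟨i, hi, rfl⟩ := List.getElem_of_mem hb
    refine decide_eq_true ⟨i, hi, (ratNumLt_iff _ _ _).2 ?_⟩
    have he : entry ((a, c, n), i) = (Denumerable.ofNat (List ℕ) c)[i] := by
      simp only [entry, List.getElem?_eq_getElem hi, Option.getD_some]
    rw [he]
    have h2 := (abs_lt.1 (hφd a ((Denumerable.ofNat (List ℕ) c)[i]).unpair.1 n)).2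
    dsimp only
    linarith

end ComputableMetricSpace

/-! ### Reduction by preprocessing, and limits in Baire space -/

namespace MultiFun

/-- Strong reducibility via a total preprocessing function, where the output is not changed. -/
theorem StrongReducible.of_preprocessing {X Y Z : Type*} {f : MultiFun X Y} {g : MultiFun Z Y}
    {H : (ℕ → ℕ) → ℕ → ℕ} (hH : OracleComputable H) (ht : f.tgt = g.tgt)
    (h : ∀ p x, f.src.names p x → x ∈ f.dom →
      ∃ z ∈ g.dom, g.src.names (H p) z ∧ g.val z ⊆ f.val x) : f.StrongReducible g := by
  refine ⟨PFun.id _, fun p => Part.some (H p), baireComputable_id, hH.baireComputable, ?_⟩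
  intro G hG p x hp hx
  obtain ⟨z, hz, hn, hsub⟩ := h p x hp hx
  obtain ⟨q, hq, y, hy, hqy⟩ := hG (H p) z hn hz
  refine ⟨q, ?_, y, hsub hy, ht ▸ hqy⟩
  rw [PFun.id_comp]
  exact Part.mem_bind_iff.2 ⟨H p, Part.mem_some _, hq⟩

end MultiFun

theorem isBaireLim_iff {p q : ℕ → ℕ} :
    IsBaireLim p q ↔ ∀ k, ∀ᶠ s in atTop, p (Nat.pair s k) = q k := by
  rw [IsBaireLim, tendsto_pi_nhds]
  simp only [nhds_discrete, tendsto_pure]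
  rfl

theorem eventually_two_inv_pow_mul_le (C : ℝ) {ε : ℝ} (hε : 0 < ε) :
    ∀ᶠ n : ℕ in atTop, C * (2 : ℝ)⁻¹ ^ n ≤ ε := by
  have h : Tendsto (fun n : ℕ => C * (2 : ℝ)⁻¹ ^ n) atTop (𝓝 (C * 0)) :=
    (tendsto_pow_atTop_nhds_zero_of_lt_one (by norm_num) (by norm_num)).const_mul C
  rw [mul_zero] at h
  exact (h.eventually (gt_mem_nhds hε)).mono fun _ => le_of_lt

namespace ComputableMetricSpace

variable {X : Type*} [ComputableMetricSpace X]

theorem mem_ratBalls {x : X} {c : ℕ} : x ∈ ratBalls X c ↔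
    ∃ b ∈ Denumerable.ofNat (List ℕ) c,
      dist x (α b.unpair.1) < nonnegRatNum b.unpair.2 := by
  simp [ratBalls, ratBall]

theorem isOpen_ratBalls (c : ℕ) : IsOpen (ratBalls X c) :=
  isOpen_biUnion fun _ _ => Metric.isOpen_ball

theorem dist_le_of_cauchyRep {p : ℕ → ℕ} {x : X} (h : (cauchyRep X).names p x) (n : ℕ) :
    dist (α (X := X) (p n)) x ≤ (2 : ℝ)⁻¹ ^ n := by
  refine le_of_tendsto (tendsto_const_nhds.dist h.2) ?_
  filter_upwards [eventually_gt_atTop n] with k hk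
  exact (h.1 n k hk).le

theorem cauchyRep_const (a : ℕ) : (cauchyRep X).names (fun _ => a) (α a) :=
  ⟨fun n k _ => by rw [dist_self]; positivity, tendsto_const_nhds⟩

/-! ### Reduction of the jump of compact choice to the Bolzano–Weierstraß problem -/

/-- A sequence that is eventually in each neighbourhood of a compact set is relatively compact. -/
theorem isCompact_closure_range {K : Set X} (hK : IsCompact K) {u : ℕ → X}
    (hu : ∀ U, IsOpen U → K ⊆ U → ∀ᶠ s in atTop, u s ∈ U) : IsCompact (closure (range u)) := by
  have h : IsCompact (K ∪ range u) := by
    refine isCompact_of_finite_subcover fun {ι} U hU hcov => ?_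
    obtain ⟨t, ht⟩ := hK.elim_finite_subcover U hU (subset_union_left.trans hcov)
    obtain ⟨N, hN⟩ := eventually_atTop.1 (hu _ (isOpen_biUnion fun i _ => hU i) ht)
    have h1 : ∀ s, ∃ i, u s ∈ U i := fun s =>
      mem_iUnion.1 (hcov (Or.inr (mem_range_self s)))
    choose j hj using h1
    classical
    refine ⟨t ∪ (Finset.range N).image j, ?_⟩
    rintro x (hx | ⟨s, rfl⟩)
    · exact biUnion_subset_biUnion_left (by simp) (ht hx)
    · rcases lt_or_ge s N with hs | hs
      · exact mem_biUnion (x := j s)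
          (by simpa using Or.inr ⟨s, hs, rfl⟩) (hj s)
      · exact biUnion_subset_biUnion_left (by simp) (hN s hs)
  exact h.closure_of_subset subset_union_right

theorem mem_of_mapClusterPt {K : Set X} (hK : IsCompact K) {u : ℕ → X}
    (hu : ∀ U, IsOpen U → K ⊆ U → ∀ᶠ s in atTop, u s ∈ U) {x : X}
    (hx : MapClusterPt x atTop u) : x ∈ K := by
  by_contra h
  obtain ⟨U, V, hU, hV, hxU, hKV, hd⟩ := SeparatedNhds.of_isCompact_isCompact isCompact_singleton hK
    (disjoint_singleton_left.2 h)
  obtain ⟨s, hs1, hs2⟩ := ((mapClusterPt_iff_frequently.1 hx U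
    (hU.mem_nhds (hxU rfl))).and_eventually (hu V hV hKV)).exists
  exact disjoint_left.1 hd hs1 hs2

variable (X)

theorem compactChoice_derivative_le_BWT :
    (compactChoice X).derivative.StrongReducible (BWT X) := by
  obtain ⟨near, hnear, hsound, hcompl⟩ := exists_near X
  -- `W p ((s, k), a)`: the point `α a` is in the first `k` sets that are listed at stage `s`
  let W (p : ℕ → ℕ) (x : (ℕ × ℕ) × ℕ) : Bool :=
    decide (∀ i < x.1.2, near (x.2, p (Nat.pair x.1.1 i), x.1.1) = true)
  -- The second argument is the shortfall from depth `s`, so the least successful shortfall gives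
  -- the greatest depth. If the search fails, the depth is 0 and the test on points is vacuous.
  let V (p : ℕ → ℕ) (x : ℕ × ℕ) : Bool := decide (∃ a < x.1, W p ((x.1, x.1 - x.2), a) = true)
  let depth (p : ℕ → ℕ) (s : ℕ) : ℕ := s - boundedSearch (fun i => V p (s, i)) s
  let point (p : ℕ → ℕ) (s : ℕ) : ℕ := boundedSearch (fun a => W p ((s, depth p s), a)) s
  have oc {β γ : Type} [Primcodable β] [Primcodable γ] {f : β → γ} (hf : Computable f) :=
    OracleComputable.of_computable hf
  have hW : OracleComputable W := by
    have hs : Computable fun y : ((ℕ × ℕ) × ℕ) × ℕ => y.1.1.1 :=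
      Computable.fst.comp (Computable.fst.comp Computable.fst)
    exact (hnear.comp ((oc (Computable.snd.comp Computable.fst)).pair
      ((OracleComputable.oracle.comp (oc (Primrec₂.natPair.to_comp.comp hs Computable.snd))).pair
        (oc hs)))).forall_lt (oc (Computable.snd.comp Computable.fst))
  have hV : OracleComputable V :=
    (hW.comp (oc (((Computable.fst.comp Computable.fst).pair
      (Primrec.nat_sub.to_comp.comp (Computable.fst.comp Computable.fst)
        (Computable.snd.comp Computable.fst))).pair Computable.snd))).exists_lt (oc Computable.fst)
  have hdepth : OracleComputable depth :=
    OracleComputable.map₂ (h := fun a b : ℕ => a - b) Primrec.nat_sub.to_comp (oc Computable.id)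
      (hV.boundedSearch (oc Computable.id))
  have hpoint : OracleComputable point :=
    OracleComputable.boundedSearch (P := fun p y => W p ((y.1, depth p y.1), y.2))
      (hW.comp (((oc Computable.fst).pair (hdepth.comp (oc Computable.fst))).pair
        (oc Computable.snd))) (oc Computable.id)
  refine MultiFun.StrongReducible.of_preprocessing (H := fun p n => point p n.unpair.1)
    (hpoint.comp (oc (Computable.fst.comp Computable.unpair))) rfl ?_
  rintro p K ⟨q, hpq, hq⟩ ⟨y, hy⟩
  have hpq := isBaireLim_iff.1 hpq
  have hqK (i : ℕ) : (K : Set X) ⊆ ratBalls X (q i) := (hq _).1 ⟨i, rfl⟩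
  -- the selected points are eventually in each listed set
  have key (k : ℕ) : ∀ᶠ s in atTop, α (point p s) ∈ ratBalls X (q k) := by
    -- Nonemptiness of `K` enters here: it makes this open set nonempty, so that it contains a dense
    -- point.
    have hO : IsOpen (⋂ i ∈ Finset.range (k + 1), ratBalls X (q i)) :=
      isOpen_biInter_finset fun i _ => isOpen_ratBalls _
    obtain ⟨a, ha⟩ := denseRange_α.exists_mem_open hO
      ⟨y, mem_iInter₂.2 fun i _ => hqK i hy⟩
    have ha' (i : ℕ) (hi : i < k + 1) : ∀ᶠ s in atTop, near (a, p (Nat.pair s i), s) = true := by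
      obtain ⟨b, hb, hd⟩ := mem_ratBalls.1 (mem_iInter₂.1 ha i (Finset.mem_range.2 hi))
      filter_upwards [hpq i, eventually_two_inv_pow_mul_le 4 (sub_pos.2 hd)] with s h1 h2
      rw [h1]
      exact hcompl _ _ _ b hb (by linarith)
    have hev := (eventually_all_finite (Set.finite_lt_nat (k + 1))).2 ha'
    filter_upwards [hev, hpq k, eventually_gt_atTop a, eventually_gt_atTop k] with s h1 h2 h3 h4
    have hWa : W p ((s, k + 1), a) = true := decide_eq_true h1
    have hVk : V p (s, s - (k + 1)) = true := by
      refine decide_eq_true ⟨a, h3, ?_⟩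
      simpa only [Nat.sub_sub_self h4] using hWa
    have hle := boundedSearch_le_of (P := fun i => V p (s, i)) (n := s) hVk
    have hlt : boundedSearch (fun i => V p (s, i)) s < s := by omega
    obtain ⟨a', ha1, ha2⟩ := of_decide_eq_true ((boundedSearch_spec _ _).2.2 hlt)
    have hpt : W p ((s, depth p s), point p s) = true :=
      (boundedSearch_spec (fun a => W p ((s, depth p s), a)) s).2.2
        (boundedSearch_lt_iff.2 ⟨a', ha1, ha2⟩)
    -- The point `a` witnesses depth `k + 1`, so the maximal depth includes the test for the set
    -- with index `k`.
    have hdep : k < depth p s := by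
      change k < s - boundedSearch (fun i => V p (s, i)) s
      omega
    obtain ⟨b, hb, hd⟩ := hsound _ _ _ (of_decide_eq_true hpt k hdep)
    dsimp only at hb hd
    rw [h2] at hb
    have h5 : (0 : ℝ) < 2⁻¹ ^ s := by positivity
    exact mem_ratBalls.2 ⟨b, hb, by linarith⟩
  have hu (U : Set X) (hU : IsOpen U) (hKU : (K : Set X) ⊆ U) :
      ∀ᶠ s in atTop, α (point p s) ∈ U := by
    obtain ⟨c, hc, hcU⟩ := exists_ratBalls K.isCompact hU hKU
    obtain ⟨k, rfl⟩ := (hq c).2 hc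
    exact (key k).mono fun s hs => hcU hs
  refine ⟨fun s => α (point p s), (mem_dom_BWT X _).2 (isCompact_closure_range K.isCompact hu),
    fun s => ?_, fun x hx => mem_of_mapClusterPt K.isCompact hu hx.2⟩
  have : component (fun n => point p n.unpair.1) s = fun _ => point p s := by
    funext j
    simp [component]
  rw [this]
  exact cauchyRep_const _

/-! ### Reduction of the Bolzano–Weierstraß problem to the jump of compact choice -/

theorem BWT_le_compactChoice_derivative :
    (BWT X).StrongReducible (compactChoice X).derivative := by
  obtain ⟨near, hnear, hsound, hcompl⟩ := exists_near X
  -- the first test, for the pair `(j, i)`, of the statement that from the index `j.unpair.2` on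
  -- the sequence is in the union of slightly smaller balls than those coded by `j.unpair.1`
  let test (p : ℕ → ℕ) (j i : ℕ) : Bool :=
    near (p (Nat.pair (j.unpair.2 + i) j.unpair.2), j.unpair.1, j.unpair.2)
  let stable (p : ℕ → ℕ) (s j : ℕ) : Bool := decide (∀ i < s, test p j i = true)
  -- Starting the search at `k` ensures that no good index is skipped: each one is its own limit
  -- value.
  let index (p : ℕ → ℕ) (s k : ℕ) : ℕ := k + boundedSearch (fun i => stable p s (k + i)) s
  have oc {β γ : Type} [Primcodable β] [Primcodable γ] {f : β → γ} (hf : Computable f) :=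
    OracleComputable.of_computable hf
  have htest : OracleComputable fun p (x : ℕ × ℕ) => test p x.1 x.2 := by
    have hj := Computable.unpair.comp (Computable.fst (α := ℕ) (β := ℕ))
    have hj2 := Computable.snd.comp hj
    exact hnear.comp ((OracleComputable.oracle.comp (oc (Primrec₂.natPair.to_comp.comp
      (Primrec.nat_add.to_comp.comp hj2 Computable.snd) hj2))).pair
        (oc ((Computable.fst.comp hj).pair hj2)))
  have hstable : OracleComputable fun p (x : ℕ × ℕ) => stable p x.1 x.2 :=
    (htest.comp (oc ((Computable.snd.comp Computable.fst).pair Computable.snd))).forall_lt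
      (oc Computable.fst)
  have hindex : OracleComputable fun p (x : ℕ × ℕ) => index p x.1 x.2 :=
    OracleComputable.map₂ (h := fun a b : ℕ => a + b) Primrec.nat_add.to_comp (oc Computable.snd)
      ((hstable.comp (oc ((Computable.fst.comp Computable.fst).pair
        (Primrec.nat_add.to_comp.comp (Computable.snd.comp Computable.fst)
          Computable.snd)))).boundedSearch (oc Computable.fst))
  refine MultiFun.StrongReducible.of_preprocessing
    (H := fun p n => (index p n.unpair.1 n.unpair.2).unpair.1)
    (OracleComputable.map (h := fun m : ℕ => m.unpair.1) (Computable.fst.comp Computable.unpair)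
      (hindex.comp (oc Computable.unpair))) rfl ?_
  intro p u hp hdom
  have hcpt := (mem_dom_BWT X u).1 hdom
  obtain ⟨y, -, hy⟩ := hdom
  have hAcl : IsClosed {x | MapClusterPt x atTop u} := isClosed_setOfPred_clusterPt
  have hAsub : {x | MapClusterPt x atTop u} ⊆ closure (range u) := fun x hx =>
    mem_closure_iff_nhds.2 fun t ht =>
      let ⟨i, hi⟩ := (mapClusterPt_iff_frequently.1 hx t ht).exists
      ⟨u i, hi, mem_range_self i⟩
  have hAc : IsCompact {x | MapClusterPt x atTop u} := hcpt.of_isClosed_subset hAcl hAsub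
  -- Infinitely many terms outside `U` would, by compactness, cluster outside `U`.
  have hev (U : Set X) (hU : IsOpen U) (hAU : {x | MapClusterPt x atTop u} ⊆ U) :
      ∀ᶠ i in atTop, u i ∈ U := by
    by_contra h
    obtain ⟨x, hx, hxc⟩ := (hcpt.inter_right hU.isClosed_compl).exists_mapClusterPt_of_frequently
      (f := u) (l := atTop) ((not_eventually.1 h).mono fun i hi =>
        ⟨subset_closure (mem_range_self i), hi⟩)
    exact hx.2 (hAU hxc)
  let good (j : ℕ) : Prop := ∀ i, test p j i = true
  have good_sound (j : ℕ) (hj : good j) :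
      {x | MapClusterPt x atTop u} ⊆ ratBalls X j.unpair.1 := by
    intro x hx
    -- Of the margin `2 * 2⁻ⁿ` given by `near`, one `2⁻ⁿ` pays for approximating the term. The other
    -- leaves closed balls strictly inside the open ones, and closedness passes to cluster points.
    have hC : IsClosed (⋃ b ∈ {b | b ∈ Denumerable.ofNat (List ℕ) j.unpair.1},
        Metric.closedBall (α (X := X) b.unpair.1)
          (nonnegRatNum b.unpair.2 - (2 : ℝ)⁻¹ ^ j.unpair.2)) :=
      (List.finite_toSet _).isClosed_biUnion fun _ _ => Metric.isClosed_closedBall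
    have huC (i : ℕ) : u (j.unpair.2 + i) ∈ ⋃ b ∈ {b | b ∈ Denumerable.ofNat (List ℕ) j.unpair.1},
        Metric.closedBall (α (X := X) b.unpair.1)
          (nonnegRatNum b.unpair.2 - (2 : ℝ)⁻¹ ^ j.unpair.2) := by
      obtain ⟨b, hb, hd⟩ := hsound _ _ _ (hj i)
      have h1 := dist_le_of_cauchyRep (hp (j.unpair.2 + i)) j.unpair.2
      have h2 := dist_triangle_left (u (j.unpair.2 + i)) (α b.unpair.1)
        (α (X := X) (component p (j.unpair.2 + i) j.unpair.2))
      refine mem_biUnion (x := b) hb (Metric.mem_closedBall.2 ?_)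
      simp only [component] at h1 h2
      linarith
    have hxC := by_contra fun h => by
      obtain ⟨i, hi, hji⟩ := ((mapClusterPt_iff_frequently.1 hx _
        (hC.isOpen_compl.mem_nhds h)).and_eventually (eventually_ge_atTop j.unpair.2)).exists
      obtain ⟨i, rfl⟩ := Nat.exists_eq_add_of_le hji
      exact hi (huC i)
    obtain ⟨b, hb, hd⟩ := mem_iUnion₂.1 hxC
    have h1 : (0 : ℝ) < 2⁻¹ ^ j.unpair.2 := by positivity
    exact mem_ratBalls.2 ⟨b, hb, by linarith [Metric.mem_closedBall.1 hd]⟩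
  have good_complete (c : ℕ) (hc : {x | MapClusterPt x atTop u} ⊆ ratBalls X c) :
      ∀ᶠ n in atTop, good (Nat.pair c n) := by
    -- The 5 is the 4 required for completeness of `near` plus 1 for approximating the term. These
    -- sets increase to `ratBalls X c`, so compactness selects a single `N`.
    let U (n : ℕ) : Set X := ⋃ b ∈ Denumerable.ofNat (List ℕ) c,
      Metric.ball (α b.unpair.1) (nonnegRatNum b.unpair.2 - 5 * (2 : ℝ)⁻¹ ^ n)
    have hmono : Monotone U := fun m n hmn => iUnion₂_mono fun b _ => Metric.ball_subset_ball (by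
      have := pow_le_pow_of_le_one (by norm_num : (0 : ℝ) ≤ 2⁻¹) (by norm_num) hmn
      linarith)
    obtain ⟨N, hN⟩ := hAc.elim_directed_cover U
      (fun n => isOpen_biUnion fun _ _ => Metric.isOpen_ball) (fun x hx => by
        obtain ⟨b, hb, hd⟩ := mem_ratBalls.1 (hc hx)
        obtain ⟨n, hn⟩ := (eventually_two_inv_pow_mul_le 5 (half_pos (sub_pos.2 hd))).exists
        exact mem_iUnion.2 ⟨n, mem_iUnion₂.2 ⟨b, hb, by rw [Metric.mem_ball]; linarith⟩⟩)
      hmono.directed_le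
    obtain ⟨M, hM⟩ := eventually_atTop.1
      (hev (U N) (isOpen_biUnion fun _ _ => Metric.isOpen_ball) hN)
    filter_upwards [eventually_ge_atTop M, eventually_ge_atTop N] with n hMn hNn i
    obtain ⟨b, hb, hd⟩ := mem_iUnion₂.1 (hmono hNn (hM (n + i) (by omega)))
    rw [Metric.mem_ball] at hd
    have h1 := dist_le_of_cauchyRep (hp (n + i)) n
    have h2 := dist_triangle (α (X := X) (component p (n + i) n)) (u (n + i)) (α b.unpair.1)
    simp only [test, Nat.unpair_pair]
    exact hcompl _ _ _ b hb (by simp only [component] at h1 h2 ⊢; linarith)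
  -- Some cover is good for all large `n`, so good indices are unbounded.
  have hgood (k : ℕ) : ∃ i, good (k + i) := by
    obtain ⟨c, hc, -⟩ := exists_ratBalls hAc isOpen_univ (subset_univ _)
    obtain ⟨n, hn, hkn⟩ := ((good_complete c hc).and (eventually_ge_atTop k)).exists
    obtain ⟨i, hi⟩ := Nat.exists_eq_add_of_le (hkn.trans (Nat.right_le_pair c n))
    exact ⟨i, hi ▸ hn⟩
  classical
  let q (k : ℕ) : ℕ := k + Nat.find (hgood k)
  have hlim (k : ℕ) : ∀ᶠ s in atTop, index p s k = q k := by
    -- A bad candidate fails at some test `m` and is rejected at every stage beyond `m`.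
    have hbad (i : ℕ) (hi : i < Nat.find (hgood k)) :
        ∀ᶠ s in atTop, stable p s (k + i) = false := by
      have h1 := Nat.find_min (hgood k) hi
      obtain ⟨m, hm⟩ := not_forall.1 h1
      filter_upwards [eventually_gt_atTop m] with s hs
      exact decide_eq_false fun h => hm (h m hs)
    filter_upwards [(eventually_all_finite (Set.finite_lt_nat _)).2 hbad,
      eventually_gt_atTop (Nat.find (hgood k))] with s h1 h2
    have h3 : stable p s (k + Nat.find (hgood k)) = true :=
      decide_eq_true fun i _ => Nat.find_spec (hgood k) i
    have h4 := boundedSearch_le_of (P := fun i => stable p s (k + i)) (n := s) h3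
    have h5 : boundedSearch (fun i => stable p s (k + i)) s = Nat.find (hgood k) := by
      refine h4.antisymm (not_lt.1 fun h => ?_)
      have h6 := (boundedSearch_spec (fun i => stable p s (k + i)) s).2.2 (h.trans h2)
      rw [h1 _ h] at h6
      exact Bool.false_ne_true h6
    simp only [index, q, h5]
  refine ⟨⟨_, hAc⟩, ⟨y, hy⟩, ⟨fun k => (q k).unpair.1, ?_, fun c => ⟨?_, fun hc => ?_⟩⟩,
    fun x hx => ⟨hcpt, hx⟩⟩
  · refine isBaireLim_iff.2 fun k => (hlim k).mono fun s hs => ?_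
    simp only [Nat.unpair_pair, hs]
  · rintro ⟨k, rfl⟩
    exact good_sound _ (Nat.find_spec (hgood k))
  · obtain ⟨n, hn⟩ := (good_complete c hc).exists
    refine ⟨Nat.pair c n, ?_⟩
    have : Nat.find (hgood (Nat.pair c n)) = 0 := (Nat.find_eq_zero _).2 hn
    simp [q, this]

end ComputableMetricSpace

theorem mainTheorem2 (X : Type*) [ComputableMetricSpace X] :
    ComputableMetricSpace.BWT X ≡sW (ComputableMetricSpace.compactChoice X).derivative :=
  ⟨ComputableMetricSpace.BWT_le_compactChoice_derivative X,
    ComputableMetricSpace.compactChoice_derivative_le_BWT X⟩
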